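/- Call a permutation of $\{1,\dots,n\}$ an $a$-derangement if each of its cycles (fixed points being cycles of length $1$) is longer than $a$. Let $d_a(n,k)$ be the number of $a$-derangements of length $n$ with exactly $k$ cycles, and let $$D_{n,a}(x)=\sum_{k=1}^{\lfloor n/(a+1)\rfloor} d_a(n,k)\,x^k .$$ Then for every negative integer $-t$, every positive integer $a$, and every real $\varepsilon>0$, there exists a positive integer $N$ such that for every integer $n>N$ the polynomial $D_{n,a}(x)$ has a real root $x_t$ satisfying $|-t-x_t|<\varepsilon$. -/

import Mathlib

open Polynomial

/-- A permutation `σ` of `{0, …, n-1}` is an `a`-derangement if each of its cycles is longer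
than `a`. The parts of `σ.partition` are the lengths of all cycles of `σ`, where every fixed
point counts as a cycle of length `1`. -/
def IsADerangement (a : ℕ) {n : ℕ} (σ : Equiv.Perm (Fin n)) : Prop :=
  ∀ l ∈ σ.partition.parts, a < l

instance (a : ℕ) {n : ℕ} (σ : Equiv.Perm (Fin n)) : Decidable (IsADerangement a σ) :=
  inferInstanceAs (Decidable (∀ l ∈ σ.partition.parts, a < l))

/-- The number of cycles of a permutation, fixed points included. -/
def numCycles {n : ℕ} (σ : Equiv.Perm (Fin n)) : ℕ :=
  Multiset.card σ.partition.parts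

/-- `d_a(n, k)`: the number of `a`-derangements of length `n` with exactly `k` cycles. -/
def aDerangementCount (a n k : ℕ) : ℕ :=
  (Finset.univ.filter fun σ : Equiv.Perm (Fin n) => IsADerangement a σ ∧ numCycles σ = k).card

/-- The generating polynomial `D_{n,a}(x) = ∑_{k=1}^{⌊n/(a+1)⌋} d_a(n,k) x^k`. -/
noncomputable def aDerangementPoly (n a : ℕ) : ℝ[X] :=
  ∑ k ∈ Finset.Icc 1 (n / (a + 1)), C (aDerangementCount a n k : ℝ) * X ^ k

/-! The exponential generating function of `D_{n,a}(-s)` is `(1 - z)^s * exp (s (z + z²/2 + ⋯ +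
zᵃ/a))`. The second factor is entire, so for `s` not a natural number the `n`-th coefficient of the
product is asymptotic to that of `(1 - z)^s` times the positive value of the second factor at `z =
1` (`tendsto_coeff_oneSubPow_mul_div`, `tsum_expPartialLog_pos`). Hence `D_{n,a}(-s)` eventually has
the sign of `∏_{m<n} (m - s)`.

For small `δ`, moving `s` from `t - δ` to `t + δ` flips only the factor `m = t` of that product, so
the intermediate value theorem gives a root within `δ` of `-t`.

The generating function identity is formal: both sides satisfy the recurrence of `(1 - z) F' = -s zᵃ
F`, on the combinatorial side by removing a marked cycle from a cycle type
(`natCast_mul_aDerangementCoeff`). -/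

/-! ### Coefficients of `(1 - z)^s`: ratios, transfer to products, signs -/

/-- The binomial coefficients `(-1)ⁿ (s choose n)`, i.e. the coefficients of `(1 - z) ^ s`. -/
noncomputable def oneSubPowCoeff (s : ℝ) (n : ℕ) : ℝ :=
  ∏ m ∈ Finset.range n, ((m : ℝ) - s) / (m + 1)

lemma oneSubPowCoeff_succ (s : ℝ) (n : ℕ) :
    ((n : ℝ) + 1) * oneSubPowCoeff s (n + 1) = (n - s) * oneSubPowCoeff s n := by
  have : (n : ℝ) + 1 ≠ 0 := by positivity
  rw [oneSubPowCoeff, Finset.prod_range_succ, ← oneSubPowCoeff]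
  field_simp

lemma oneSubPowCoeff_ne_zero {s : ℝ} (hs : ∀ m : ℕ, (m : ℝ) ≠ s) (n : ℕ) :
    oneSubPowCoeff s n ≠ 0 :=
  Finset.prod_ne_zero_iff.2 fun m _ =>
    div_ne_zero (sub_ne_zero.2 (hs m)) (by positivity)

lemma oneSubPowCoeff_div_succ {s : ℝ} (hs : ∀ m : ℕ, (m : ℝ) ≠ s) (n : ℕ) :
    oneSubPowCoeff s n / oneSubPowCoeff s (n + 1) = ((n : ℝ) + 1) / (n - s) := by
  have h1 := oneSubPowCoeff_ne_zero hs (n + 1)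
  have h2 : (n : ℝ) - s ≠ 0 := sub_ne_zero.2 (hs n)
  rw [div_eq_div_iff h1 h2, oneSubPowCoeff_succ, mul_comm]

lemma tendsto_succ_div_sub (s : ℝ) :
    Filter.Tendsto (fun n : ℕ => ((n : ℝ) + 1) / (n - s)) Filter.atTop (nhds 1) := by
  have h := tendsto_add_mul_div_add_mul_atTop_nhds (𝕜 := ℝ) 1 (-s) 1 (d := 1) one_ne_zero
  simp only [one_mul, div_one] at h
  refine h.congr fun n => ?_
  rw [add_comm 1, neg_add_eq_sub]

lemma exists_bound_succ_div_sub (s : ℝ) :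
    ∃ K : ℝ, 0 ≤ K ∧ ∀ n : ℕ, |((n : ℝ) + 1) / (n - s)| ≤ K := by
  obtain ⟨K, hK⟩ := (Metric.isBounded_range_of_tendsto _ (tendsto_succ_div_sub s)).exists_norm_le
  have h : ∀ n : ℕ, |((n : ℝ) + 1) / (n - s)| ≤ K := fun n => hK _ ⟨n, rfl⟩
  exact ⟨K, (abs_nonneg _).trans (h 0), h⟩

lemma tendsto_oneSubPowCoeff_sub_div {s : ℝ} (hs : ∀ m : ℕ, (m : ℝ) ≠ s) (k : ℕ) :
    Filter.Tendsto (fun n : ℕ => oneSubPowCoeff s (n - k) / oneSubPowCoeff s n)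
      Filter.atTop (nhds 1) := by
  induction k with
  | zero =>
    simp only [Nat.sub_zero, div_self (oneSubPowCoeff_ne_zero hs _)]
    exact tendsto_const_nhds
  | succ k ih =>
    have h := ((tendsto_succ_div_sub s).comp (Filter.tendsto_sub_atTop_nat (k + 1))).mul ih
    rw [one_mul] at h
    refine h.congr' ?_
    filter_upwards [Filter.eventually_ge_atTop (k + 1)] with n hn
    rw [Function.comp_apply, ← oneSubPowCoeff_div_succ hs, show n - (k + 1) + 1 = n - k by omega,
      div_mul_div_cancel₀ (oneSubPowCoeff_ne_zero hs _)]

/-- The quotient telescopes into `k` consecutive ratios, each at most `K`. The bound does not depend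
on `n`, so it can serve as a dominating sequence. -/
lemma abs_oneSubPowCoeff_sub_div_le {s K : ℝ} (hs : ∀ m : ℕ, (m : ℝ) ≠ s) (hK0 : 0 ≤ K)
    (hK : ∀ n : ℕ, |((n : ℝ) + 1) / (n - s)| ≤ K) {n k : ℕ} (hk : k ≤ n) :
    |oneSubPowCoeff s (n - k) / oneSubPowCoeff s n| ≤ K ^ k := by
  induction k with
  | zero => simp [div_self (oneSubPowCoeff_ne_zero hs _)]
  | succ k ih =>
    rw [← div_mul_div_cancel₀ (oneSubPowCoeff_ne_zero hs (n - k)), abs_mul, pow_succ']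
    refine mul_le_mul ?_ (ih (by omega)) (abs_nonneg _) hK0
    have h := oneSubPowCoeff_div_succ hs (n - (k + 1))
    rw [show n - (k + 1) + 1 = n - k by omega] at h
    rw [h]
    exact hK _

/-- If the coefficients of `G` decay faster than any geometric sequence, the coefficients of
`(1 - z) ^ s * G` are asymptotic to those of `(1 - z) ^ s` times the value of `G` at `1`. -/
lemma tendsto_coeff_oneSubPow_mul_div {s : ℝ} (hs : ∀ m : ℕ, (m : ℝ) ≠ s) (G : PowerSeries ℝ)
    (hG : ∀ r : ℝ, 0 ≤ r → Summable fun k => |PowerSeries.coeff k G| * r ^ k) :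
    Filter.Tendsto (fun n => PowerSeries.coeff n (G * PowerSeries.mk (oneSubPowCoeff s)) /
      oneSubPowCoeff s n) Filter.atTop (nhds (∑' k, PowerSeries.coeff k G)) := by
  obtain ⟨K, hK0, hK⟩ := exists_bound_succ_div_sub s
  have key : Filter.Tendsto (fun n => ∑' k, if k ≤ n then
      PowerSeries.coeff k G * (oneSubPowCoeff s (n - k) / oneSubPowCoeff s n) else 0)
      Filter.atTop (nhds (∑' k, PowerSeries.coeff k G)) := by
    -- Tannery's theorem with dominating terms `|coeff k G| * K ^ k`; `K` is not controlled, so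
    -- summability is needed for every radius.
    refine tendsto_tsum_of_dominated_convergence (hG K hK0) (fun k => ?_)
      (Filter.Eventually.of_forall fun n k => ?_)
    · have h := (tendsto_oneSubPowCoeff_sub_div hs k).const_mul (PowerSeries.coeff k G)
      rw [mul_one] at h
      refine h.congr' ?_
      filter_upwards [Filter.eventually_ge_atTop k] with n hn
      rw [if_pos hn]
    · split_ifs with h
      · rw [Real.norm_eq_abs, abs_mul]
        exact mul_le_mul_of_nonneg_left (abs_oneSubPowCoeff_sub_div_le hs hK0 hK h) (abs_nonneg _)
      · rw [norm_zero]
        positivity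
  refine key.congr fun n => ?_
  rw [tsum_eq_sum (s := Finset.range (n + 1))
    (fun k hk => if_neg fun h => hk (Finset.mem_range.2 (by omega))), PowerSeries.coeff_mul,
    Finset.Nat.sum_antidiagonal_eq_sum_range_succ_mk, Finset.sum_div]
  refine Finset.sum_congr rfl fun k hk => ?_
  rw [if_pos (Nat.lt_succ_iff.1 (Finset.mem_range.1 hk)), PowerSeries.coeff_mk, mul_div_assoc]

/-- Pairing equal indices gives factors `((m - t)² - δ²) / (m + 1)²`, positive except at `m = t`, an
index that occurs because `t < n`. -/
lemma oneSubPowCoeff_mul_neg {t : ℕ} {δ : ℝ} (h0 : 0 < δ) (h1 : δ < 1) {n : ℕ} (hn : t < n) :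
    oneSubPowCoeff (t - δ) n * oneSubPowCoeff (t + δ) n < 0 := by
  rw [oneSubPowCoeff, oneSubPowCoeff, ← Finset.prod_mul_distrib,
    ← Finset.mul_prod_erase _ _ (Finset.mem_range.2 hn)]
  have e : ∀ m : ℕ, ((m : ℝ) - (t - δ)) / (m + 1) * ((m - (t + δ)) / (m + 1)) =
      (((m : ℝ) - t) ^ 2 - δ ^ 2) / (m + 1) ^ 2 := fun m => by
    rw [div_mul_div_comm]; ring
  simp only [e]
  refine mul_neg_of_neg_of_pos (div_neg_of_neg_of_pos ?_ (by positivity))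
    (Finset.prod_pos fun m hm => div_pos ?_ (by positivity))
  · rw [sub_self]; nlinarith
  · have hne : (m : ℤ) - t ≠ 0 := by
      have := (Finset.mem_erase.1 hm).1
      omega
    have h2 : (1 : ℝ) ≤ ((m : ℝ) - t) ^ 2 := by
      rw [one_le_sq_iff_one_le_abs]
      exact_mod_cast Int.one_le_abs hne
    nlinarith

lemma natCast_ne_add_of_abs_lt_one {t : ℕ} {δ : ℝ} (h0 : 0 < |δ|) (h1 : |δ| < 1) (m : ℕ) :
    (m : ℝ) ≠ t + δ := by
  intro h
  have h2 : δ = ((m - t : ℤ) : ℝ) := by push_cast; linarith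
  rw [h2, ← Int.cast_abs] at h0 h1
  norm_cast at h0 h1
  omega

/-! ### The entire factor and its differential equation -/

/-- The power series of `exp (s z ^ j / j)`. -/
noncomputable def expMonomial (s : ℝ) (j : ℕ) : PowerSeries ℝ :=
  PowerSeries.mk fun k => if j ∣ k then (s / j) ^ (k / j) / (k / j).factorial else 0

lemma summable_expMonomial (s : ℝ) {j : ℕ} (hj : 0 < j) (r : ℝ) :
    Summable fun k => |PowerSeries.coeff k (expMonomial s j)| * r ^ k := by
  have hinj : Function.Injective fun i : ℕ => j * i := fun _ _ h => Nat.eq_of_mul_eq_mul_left hj h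
  rw [← hinj.summable_iff]
  · refine (Real.summable_pow_div_factorial (|s / j| * r ^ j)).congr fun i => ?_
    simp only [expMonomial, PowerSeries.coeff_mk, Function.comp_apply, dvd_mul_right, if_true,
      Nat.mul_div_cancel_left i hj, abs_div, abs_pow, Nat.abs_cast]
    rw [pow_mul, mul_pow]
    ring
  · intro k hk
    have : ¬ j ∣ k := fun ⟨i, hi⟩ => hk ⟨i, hi.symm⟩
    simp [expMonomial, this]

lemma tsum_expMonomial_pos (s : ℝ) {j : ℕ} (hj : 0 < j) :
    0 < ∑' k, PowerSeries.coeff k (expMonomial s j) := by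
  have hinj : Function.Injective fun i : ℕ => j * i := fun _ _ h => Nat.eq_of_mul_eq_mul_left hj h
  have h : ∑' k, PowerSeries.coeff k (expMonomial s j) = Real.exp (s / j) := by
    rw [← hinj.tsum_eq, Real.exp_eq_exp_ℝ, NormedSpace.exp_eq_tsum_div]
    · refine tsum_congr fun i => ?_
      simp [expMonomial, Nat.mul_div_cancel_left i hj]
    · intro k hk
      by_contra h
      exact hk (by simp [expMonomial, show ¬ j ∣ k from fun ⟨i, hi⟩ => h ⟨i, hi.symm⟩])
  rw [h]
  exact Real.exp_pos _

lemma derivative_expMonomial (s : ℝ) (j : ℕ) :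
    PowerSeries.derivative ℝ (expMonomial s (j + 1)) =
      PowerSeries.C s * PowerSeries.X ^ j * expMonomial s (j + 1) := by
  ext n
  rw [mul_assoc, PowerSeries.coeff_C_mul, PowerSeries.coeff_X_pow_mul', PowerSeries.coeff_derivative,
    expMonomial, PowerSeries.coeff_mk, PowerSeries.coeff_mk]
  by_cases hd : j + 1 ∣ n + 1
  · obtain ⟨i, hi⟩ := hd
    obtain ⟨i, rfl⟩ : ∃ i', i = i' + 1 := Nat.exists_eq_succ_of_ne_zero (by rintro rfl; omega)
    -- Nonzero coefficients of the derivative sit where `n + 1 = (j + 1) * (i + 1)`.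
    obtain rfl : n = (j + 1) * i + j := by rw [Nat.mul_succ] at hi; omega
    rw [hi, if_pos (dvd_mul_right _ _), if_pos (Nat.le_add_left _ _), Nat.add_sub_cancel,
      if_pos (dvd_mul_right _ _), Nat.mul_div_cancel_left _ j.succ_pos,
      Nat.mul_div_cancel_left _ j.succ_pos, Nat.factorial_succ]
    have h1 : (((j + 1) * i + j : ℕ) : ℝ) + 1 = (j + 1) * (i + 1) := by push_cast; ring
    have h2 : (j : ℝ) + 1 ≠ 0 := by positivity
    have h3 : (i.factorial : ℝ) ≠ 0 := by positivity
    have h4 : (i : ℝ) + 1 ≠ 0 := by positivity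
    rw [h1, pow_succ]
    push_cast
    field_simp
  · rw [if_neg hd, zero_mul]
    split_ifs with h1 h2
    · refine absurd ?_ hd
      have := (Nat.dvd_add_self_right (m := j + 1)).2 h2
      rwa [show n - j + (j + 1) = n + 1 by omega] at this
    · simp
    · simp

lemma PowerSeries.summable_abs_coeff_mul {A B : PowerSeries ℝ} {r : ℝ} (hr : 0 ≤ r)
    (hA : Summable fun k => |coeff k A| * r ^ k) (hB : Summable fun k => |coeff k B| * r ^ k) :
    Summable fun k => |coeff k (A * B)| * r ^ k := by
  have h0 : ∀ (F : PowerSeries ℝ) (k : ℕ), 0 ≤ |coeff k F| * r ^ k := fun F k =>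
    mul_nonneg (abs_nonneg _) (pow_nonneg hr k)
  have hAB : Summable fun p : ℕ × ℕ => (|coeff p.1 A| * r ^ p.1) * (|coeff p.2 B| * r ^ p.2) :=
    Summable.mul_of_nonneg hA hB (h0 A) (h0 B)
  refine Summable.of_nonneg_of_le (h0 _) (fun k => ?_)
    (summable_sum_mul_antidiagonal_of_summable_mul
      (f := fun k => |coeff k A| * r ^ k) (g := fun k => |coeff k B| * r ^ k) hAB)
  rw [coeff_mul]
  refine (mul_le_mul_of_nonneg_right (Finset.abs_sum_le_sum_abs _ _) (pow_nonneg hr k)).trans ?_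
  rw [Finset.sum_mul]
  refine Finset.sum_le_sum fun p hp => le_of_eq ?_
  rw [abs_mul, ← Finset.HasAntidiagonal.mem_antidiagonal.1 hp, pow_add]
  ring

/-- The power series of `exp (s (z + z ^ 2 / 2 + ⋯ + z ^ a / a))`. -/
noncomputable def expPartialLog (s : ℝ) (a : ℕ) : PowerSeries ℝ :=
  ∏ j ∈ Finset.range a, expMonomial s (j + 1)

lemma expPartialLog_succ (s : ℝ) (a : ℕ) :
    expPartialLog s (a + 1) = expPartialLog s a * expMonomial s (a + 1) :=
  Finset.prod_range_succ _ _

lemma summable_expPartialLog (s : ℝ) (a : ℕ) {r : ℝ} (hr : 0 ≤ r) :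
    Summable fun k => |PowerSeries.coeff k (expPartialLog s a)| * r ^ k := by
  induction a with
  | zero =>
    refine summable_of_ne_finset_zero (s := {0}) fun k hk => ?_
    simp [expPartialLog, PowerSeries.coeff_one, Finset.notMem_singleton.1 hk]
  | succ a ih =>
    rw [expPartialLog_succ]
    exact PowerSeries.summable_abs_coeff_mul hr ih (summable_expMonomial s a.succ_pos r)

/-- Evaluation at `1` is multiplicative by absolute convergence, and each factor has value `exp (s /
j)`. -/
lemma tsum_expPartialLog_pos (s : ℝ) (a : ℕ) :
    0 < ∑' k, PowerSeries.coeff k (expPartialLog s a) := by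
  induction a with
  | zero => simp [expPartialLog, PowerSeries.coeff_one]
  | succ a ih =>
    have h1 := summable_expPartialLog s a zero_le_one
    have h2 := summable_expMonomial s a.succ_pos 1
    simp only [one_pow, mul_one] at h1 h2
    simp only [expPartialLog_succ, PowerSeries.coeff_mul]
    have h := tsum_mul_tsum_eq_tsum_sum_antidiagonal_of_summable_norm (R := ℝ) h1 h2
    rw [← h]
    exact mul_pos ih (tsum_expMonomial_pos s a.succ_pos)

lemma coeff_zero_expPartialLog (s : ℝ) (a : ℕ) :
    PowerSeries.coeff 0 (expPartialLog s a) = 1 := by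
  rw [expPartialLog, PowerSeries.coeff_zero_eq_constantCoeff_apply, map_prod]
  refine Finset.prod_eq_one fun j _ => ?_
  rw [← PowerSeries.coeff_zero_eq_constantCoeff_apply]
  simp [expMonomial]

/-- The logarithmic derivative is `s (1 + z + ⋯ + z^(a-1)) = s (1 - zᵃ) / (1 - z)`. -/
lemma one_sub_X_mul_derivative_expPartialLog (s : ℝ) (a : ℕ) :
    (1 - PowerSeries.X) * PowerSeries.derivative ℝ (expPartialLog s a) =
      PowerSeries.C s * (1 - PowerSeries.X ^ a) * expPartialLog s a := by
  induction a with
  | zero => simp [expPartialLog]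
  | succ a ih =>
    rw [expPartialLog_succ, Derivation.leibniz, smul_eq_mul, smul_eq_mul, derivative_expMonomial]
    linear_combination expMonomial s (a + 1) * ih

lemma one_sub_X_mul_derivative_oneSubPow (s : ℝ) :
    (1 - PowerSeries.X) * PowerSeries.derivative ℝ (PowerSeries.mk (oneSubPowCoeff s)) =
      - PowerSeries.C s * PowerSeries.mk (oneSubPowCoeff s) := by
  ext n
  have h := oneSubPowCoeff_succ s n
  rw [neg_mul, map_neg, PowerSeries.coeff_C_mul, sub_mul, one_mul, map_sub,
    PowerSeries.coeff_derivative, PowerSeries.coeff_mk, PowerSeries.coeff_mk]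
  cases n with
  | zero =>
    simp only [PowerSeries.coeff_zero_X_mul]
    linear_combination h
  | succ n =>
    rw [PowerSeries.coeff_succ_X_mul, PowerSeries.coeff_derivative, PowerSeries.coeff_mk]
    push_cast at h ⊢
    linear_combination h

lemma one_sub_X_mul_derivative_mul (s : ℝ) (a : ℕ) :
    (1 - PowerSeries.X) * PowerSeries.derivative ℝ
        (expPartialLog s a * PowerSeries.mk (oneSubPowCoeff s)) =
      - PowerSeries.C s * PowerSeries.X ^ a *
        (expPartialLog s a * PowerSeries.mk (oneSubPowCoeff s)) := by
  rw [Derivation.leibniz, smul_eq_mul, smul_eq_mul]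
  linear_combination PowerSeries.mk (oneSubPowCoeff s) * one_sub_X_mul_derivative_expPartialLog s a
    + expPartialLog s a * one_sub_X_mul_derivative_oneSubPow s

/-- A sequence satisfying the linear recurrence of `(1 - z) F' = -s zᵃ F`, `F 0 = 1`. -/
lemma eq_coeff_of_recurrence {s : ℝ} {a : ℕ} {c : ℕ → ℝ} (h0 : c 0 = 1)
    (h : ∀ n : ℕ, ((n : ℝ) + 1) * c (n + 1) = n * c n - s * if a ≤ n then c (n - a) else 0) (n : ℕ) :
    c n = PowerSeries.coeff n (expPartialLog s a * PowerSeries.mk (oneSubPowCoeff s)) := by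
  induction n using Nat.strong_induction_on with
  | _ n ih =>
    cases n with
    | zero =>
      rw [PowerSeries.coeff_mul]
      simp [h0, coeff_zero_expPartialLog, oneSubPowCoeff, - PowerSeries.coeff_zero_eq_constantCoeff]
    | succ n =>
      have e := congrArg (PowerSeries.coeff n) (one_sub_X_mul_derivative_mul s a)
      have hn := h n
      rw [neg_mul, neg_mul, mul_assoc, map_neg, PowerSeries.coeff_C_mul,
        PowerSeries.coeff_X_pow_mul', sub_mul, one_mul, map_sub,
        PowerSeries.coeff_derivative] at e
      have e2 : PowerSeries.coeff n (PowerSeries.X * PowerSeries.derivative ℝ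
          (expPartialLog s a * PowerSeries.mk (oneSubPowCoeff s))) = n * c n := by
        cases n with
        | zero => simp
        | succ n =>
          rw [PowerSeries.coeff_succ_X_mul, PowerSeries.coeff_derivative, ih (n + 1) (by omega)]
          push_cast
          ring
      rw [e2] at e
      have e3 : (if a ≤ n then c (n - a) else 0) = if a ≤ n then PowerSeries.coeff (n - a)
          (expPartialLog s a * PowerSeries.mk (oneSubPowCoeff s)) else 0 := by
        split_ifs
        · exact ih _ (by omega)
        · rfl
      rw [e3] at hn
      have hne : (n : ℝ) + 1 ≠ 0 := by positivity
      refine mul_left_cancel₀ hne ?_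
      linear_combination hn - e

/-! ### Combinatorial side: cycle types and their recurrence -/

/-- The partitions of `n` (as multisets) all of whose parts are larger than `a`. -/
def partitionsAbove (a n : ℕ) : Finset (Multiset ℕ) :=
  ((Finset.univ : Finset n.Partition).image Nat.Partition.parts).filter fun m => ∀ i ∈ m, a < i

lemma mem_partitionsAbove {a n : ℕ} {m : Multiset ℕ} :
    m ∈ partitionsAbove a n ↔ m.sum = n ∧ ∀ i ∈ m, a < i := by
  simp only [partitionsAbove, Finset.mem_filter, Finset.mem_image, Finset.mem_univ, true_and]
  refine and_congr_left fun h => ⟨?_, fun hs => ?_⟩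
  · rintro ⟨p, rfl⟩
    exact p.parts_sum
  · exact ⟨⟨m, fun hi => (Nat.zero_le a).trans_lt (h _ hi), hs⟩, rfl⟩

/-- The weight of the cycle type `m` in the exponential generating function of permutations
counted by cycles. -/
noncomputable def cycleTypeWeight (x : ℝ) (m : Multiset ℕ) : ℝ :=
  x ^ Multiset.card m / ((m.prod * ∏ i ∈ m.toFinset, (m.count i).factorial : ℕ) : ℝ)

lemma prod_factorial_count_cons (i : ℕ) (m : Multiset ℕ) :
    ∏ j ∈ (i ::ₘ m).toFinset, ((i ::ₘ m).count j).factorial =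
      (m.count i + 1) * ∏ j ∈ m.toFinset, (m.count j).factorial := by
  have h : ∏ j ∈ m.toFinset, (m.count j).factorial =
      ∏ j ∈ (i ::ₘ m).toFinset, (m.count j).factorial := by
    refine Finset.prod_subset (fun j hj => ?_) fun j _ hj => ?_
    · simp only [Multiset.mem_toFinset, Multiset.mem_cons] at hj ⊢
      exact Or.inr hj
    · rw [Multiset.count_eq_zero.2 (by simpa using hj), Nat.factorial_zero]
  have hi : i ∈ (i ::ₘ m).toFinset := by simp
  rw [h, ← Finset.mul_prod_erase _ _ hi, ← Finset.mul_prod_erase _ _ hi, ← mul_assoc,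
    Multiset.count_cons_self, Nat.factorial_succ]
  congr 1
  refine Finset.prod_congr rfl fun j hj => ?_
  rw [Multiset.count_cons_of_ne (Finset.ne_of_mem_erase hj)]

/-- The multiplicity `count i + 1` and the length `i` are exactly what the new part adds to the
denominator. -/
lemma cycleTypeWeight_cons (x : ℝ) {i : ℕ} (hi : 0 < i) (m : Multiset ℕ) :
    ((m.count i + 1 : ℕ) : ℝ) * i * cycleTypeWeight x (i ::ₘ m) = x * cycleTypeWeight x m := by
  have h1 : (i : ℝ) ≠ 0 := by positivity
  have h2 : ((m.count i : ℝ) + 1) ≠ 0 := by positivity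
  rw [cycleTypeWeight, cycleTypeWeight, prod_factorial_count_cons, Multiset.card_cons,
    Multiset.prod_cons, pow_succ]
  push_cast
  rw [show (i : ℝ) * (m.map (Nat.cast : ℕ → ℝ)).prod * (((m.count i : ℝ) + 1) *
      ∏ j ∈ m.toFinset, ((m.count j).factorial : ℝ)) = (((m.count i : ℝ) + 1) * i) *
      ((m.map (Nat.cast : ℕ → ℝ)).prod * ∏ j ∈ m.toFinset, ((m.count j).factorial : ℝ)) by ring,
    ← mul_div_assoc, mul_div_mul_left _ _ (mul_ne_zero h2 h1)]
  ring

/-- The coefficients of the exponential generating function of `a`-derangements. -/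
noncomputable def aDerangementCoeff (x : ℝ) (a n : ℕ) : ℝ :=
  ∑ m ∈ partitionsAbove a n, cycleTypeWeight x m

lemma aDerangementCoeff_zero (x : ℝ) (a : ℕ) : aDerangementCoeff x a 0 = 1 := by
  have h : partitionsAbove a 0 = {0} := by
    ext m
    rw [mem_partitionsAbove, Finset.mem_singleton]
    refine ⟨fun ⟨h1, h2⟩ => Multiset.eq_zero_of_forall_notMem fun i hi => ?_, ?_⟩
    · have := h2 i hi
      have := Multiset.le_sum_of_mem hi
      omega
    · rintro rfl
      simp
  simp [aDerangementCoeff, h, cycleTypeWeight]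

/-- Write `n` as the sum of the parts of `m`, grouped by value, and remove the chosen part `i`: what
is left is a partition of `j = n - i`, and `a < i` becomes `j < n - a`. -/
lemma natCast_mul_aDerangementCoeff (x : ℝ) (a n : ℕ) :
    (n : ℝ) * aDerangementCoeff x a n =
      x * ∑ j ∈ Finset.range (n - a), aDerangementCoeff x a j := by
  have h : ∀ m ∈ partitionsAbove a n, (n : ℝ) * cycleTypeWeight x m =
      ∑ i ∈ m.toFinset, (m.count i : ℝ) * i * cycleTypeWeight x m := fun m hm => by
    rw [← Finset.sum_mul]
    congr 1
    rw [← (mem_partitionsAbove.1 hm).1, Finset.sum_multiset_count]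
    push_cast
    simp
  simp only [aDerangementCoeff, Finset.mul_sum]
  rw [Finset.sum_congr rfl h, Finset.sum_sigma', Finset.sum_sigma']
  refine Finset.sum_bij' (fun p _ => ⟨n - p.2, p.1.erase p.2⟩)
    (fun q _ => ⟨(n - q.1) ::ₘ q.2, n - q.1⟩) ?_ ?_ ?_ ?_ ?_
  · rintro ⟨m, i⟩ hp
    simp only [Finset.mem_sigma, mem_partitionsAbove, Multiset.mem_toFinset,
      Finset.mem_range] at hp ⊢
    obtain ⟨⟨h1, h2⟩, hi⟩ := hp
    have h3 := Multiset.sum_erase hi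
    have h4 := h2 i hi
    exact ⟨by omega, by omega, fun k hk => h2 k (Multiset.mem_of_mem_erase hk)⟩
  · rintro ⟨j, m⟩ hq
    simp only [Finset.mem_sigma, mem_partitionsAbove, Multiset.mem_toFinset, Finset.mem_range,
      Multiset.sum_cons, Multiset.mem_cons, forall_eq_or_imp, true_or, and_true] at hq ⊢
    obtain ⟨h0, h1, h2⟩ := hq
    exact ⟨by omega, by omega, h2⟩
  · rintro ⟨m, i⟩ hp
    simp only [Finset.mem_sigma, mem_partitionsAbove, Multiset.mem_toFinset] at hp
    obtain ⟨⟨h1, h2⟩, hi⟩ := hp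
    have h3 := Multiset.le_sum_of_mem hi
    have h4 : n - (n - i) = i := by omega
    simp only [h4, Multiset.cons_erase hi]
  · rintro ⟨j, m⟩ hq
    simp only [Finset.mem_sigma, Finset.mem_range] at hq
    have h4 : n - (n - j) = j := by omega
    simp only [h4, Multiset.erase_cons_head]
  · rintro ⟨m, i⟩ hp
    simp only [Finset.mem_sigma, mem_partitionsAbove, Multiset.mem_toFinset] at hp
    obtain ⟨⟨h1, h2⟩, hi⟩ := hp
    have h5 := cycleTypeWeight_cons x ((Nat.zero_le a).trans_lt (h2 i hi)) (m.erase i)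
    rwa [Multiset.cons_erase hi, ← Multiset.count_cons_self, Multiset.cons_erase hi] at h5

lemma aDerangementCoeff_recurrence (x : ℝ) (a n : ℕ) :
    ((n : ℝ) + 1) * aDerangementCoeff x a (n + 1) = n * aDerangementCoeff x a n +
      x * if a ≤ n then aDerangementCoeff x a (n - a) else 0 := by
  -- Subtracting the summed identities for `n + 1` and `n` leaves the single term `j = n - a`, or
  -- nothing when both ranges are empty.
  rw [← Nat.cast_succ, natCast_mul_aDerangementCoeff, natCast_mul_aDerangementCoeff]
  split_ifs with h
  · rw [Nat.succ_sub h, Finset.sum_range_succ, mul_add]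
  · rw [show n.succ - a = 0 by omega, show n - a = 0 by omega]
    simp

lemma card_filter_cycleType {n : ℕ} {m : Multiset ℕ} (hs : m.sum = n) (hm : ∀ i ∈ m, 1 < i)
    (x : ℝ) : ((Finset.univ.filter fun σ : Equiv.Perm (Fin n) => σ.cycleType = m).card : ℝ) *
      x ^ Multiset.card m = n.factorial * cycleTypeWeight x m := by
  have h := Equiv.Perm.card_of_cycleType_mul_eq (Fin n) m
  rw [if_pos ⟨by simp [hs], hm⟩, Fintype.card_fin, hs, Nat.sub_self, Nat.factorial_zero,
    one_mul] at h
  have h0 : (m.prod * ∏ i ∈ m.toFinset, (m.count i).factorial) ≠ 0 := fun h0 => by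
    rw [h0, mul_zero] at h
    exact n.factorial_ne_zero h.symm
  rw [cycleTypeWeight, ← h, Nat.cast_mul, mul_assoc,
    mul_div_cancel₀ _ (Nat.cast_ne_zero.2 h0)]

/-- `cycleType` omits fixed points and `partition` records them as ones; without parts equal to `1`
the two agree. -/
lemma partition_parts_eq_iff {n : ℕ} {m : Multiset ℕ} (hs : m.sum = n) (hm : ∀ i ∈ m, 1 < i)
    (σ : Equiv.Perm (Fin n)) : σ.partition.parts = m ↔ σ.cycleType = m := by
  constructor
  · intro h
    rw [← Equiv.Perm.filter_parts_partition_eq_cycleType, h]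
    exact Multiset.filter_eq_self.2 hm
  · intro h
    rw [Equiv.Perm.parts_partition, ← Equiv.Perm.sum_cycleType, h, hs]
    simp

lemma partition_parts_sum {n : ℕ} (σ : Equiv.Perm (Fin n)) : σ.partition.parts.sum = n := by
  rw [σ.partition.parts_sum, Fintype.card_fin]

/-- Ensures that the summation range in `aDerangementPoly` misses no `a`-derangement. -/
lemma numCycles_mem_Icc {a n : ℕ} (hn : 0 < n) {σ : Equiv.Perm (Fin n)}
    (hσ : IsADerangement a σ) : numCycles σ ∈ Finset.Icc 1 (n / (a + 1)) := by
  rw [Finset.mem_Icc, Nat.le_div_iff_mul_le a.succ_pos]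
  have h := partition_parts_sum σ
  constructor
  · refine Nat.one_le_iff_ne_zero.2 fun h0 => hn.ne' ?_
    rw [← h, Multiset.card_eq_zero.1 h0, Multiset.sum_zero]
  · have h2 := Multiset.card_nsmul_le_sum (s := σ.partition.parts) (a := a + 1) hσ
    rwa [h, smul_eq_mul] at h2

lemma eval_aDerangementPoly {a n : ℕ} (ha : 0 < a) (hn : 0 < n) (x : ℝ) :
    (aDerangementPoly n a).eval x = n.factorial * aDerangementCoeff x a n := by
  have h1 : (aDerangementPoly n a).eval x = ∑ σ : Equiv.Perm (Fin n) with IsADerangement a σ,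
      x ^ numCycles σ := by
    rw [aDerangementPoly, eval_finsetSum, ← Finset.sum_fiberwise_of_maps_to
      (g := numCycles) (t := Finset.Icc 1 (n / (a + 1)))
      fun σ hσ => numCycles_mem_Icc hn (Finset.mem_filter.1 hσ).2]
    refine Finset.sum_congr rfl fun k _ => ?_
    rw [Finset.sum_congr rfl fun σ hσ => by rw [(Finset.mem_filter.1 hσ).2], Finset.sum_const,
      Finset.filter_filter, nsmul_eq_mul, eval_mul, eval_C, eval_pow, eval_X, aDerangementCount]
  have h2 : ∀ σ ∈ Finset.univ.filter (fun σ : Equiv.Perm (Fin n) => IsADerangement a σ),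
      σ.partition.parts ∈ partitionsAbove a n := fun σ hσ =>
    mem_partitionsAbove.2 ⟨partition_parts_sum σ, (Finset.mem_filter.1 hσ).2⟩
  rw [h1, aDerangementCoeff, Finset.mul_sum, ← Finset.sum_fiberwise_of_maps_to h2]
  refine Finset.sum_congr rfl fun m hm => ?_
  obtain ⟨hs, hm⟩ := mem_partitionsAbove.1 hm
  have hm1 : ∀ i ∈ m, 1 < i := fun i hi => (Nat.succ_le_of_lt ha).trans_lt (hm i hi)
  rw [← card_filter_cycleType hs hm1, Finset.filter_filter, ← nsmul_eq_mul, ← Finset.sum_const]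
  refine Finset.sum_congr ?_ fun σ hσ => ?_
  · ext σ
    simp only [Finset.mem_filter, Finset.mem_univ, true_and, ← partition_parts_eq_iff hs hm1]
    refine ⟨And.right, fun h => ⟨?_, h⟩⟩
    rw [IsADerangement, h]
    exact hm
  · rw [numCycles, (partition_parts_eq_iff hs hm1 σ).2 (Finset.mem_filter.1 hσ).2]

/-! ### Signs of the polynomial and the root -/

/-- For a fixed non-integer `s`, the sign of `D_{n,a}(-s)` is eventually that of
`(-1)ⁿ (s choose n)`. -/
lemma eventually_eval_aDerangementPoly_div_pos {s : ℝ} (hs : ∀ m : ℕ, (m : ℝ) ≠ s) {a : ℕ}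
    (ha : 0 < a) : ∀ᶠ n in Filter.atTop,
      0 < (aDerangementPoly n a).eval (-s) / oneSubPowCoeff s n := by
  have h := tendsto_coeff_oneSubPow_mul_div hs (expPartialLog s a)
    fun r hr => summable_expPartialLog s a hr
  filter_upwards [h.eventually_const_lt (tsum_expPartialLog_pos s a),
    Filter.eventually_gt_atTop 0] with n hn hn0
  rw [← eq_coeff_of_recurrence (c := aDerangementCoeff (-s) a) (aDerangementCoeff_zero _ _)
    fun n => by rw [aDerangementCoeff_recurrence]; ring] at hn
  rw [eval_aDerangementPoly ha hn0, mul_div_assoc]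
  positivity

theorem theorem5 (t : ℕ) (ht : 0 < t) (a : ℕ) (ha : 0 < a) (ε : ℝ) (hε : 0 < ε) :
    ∃ N : ℕ, 0 < N ∧ ∀ n : ℕ, N < n →
      ∃ x : ℝ, (aDerangementPoly n a).IsRoot x ∧ |-(t : ℝ) - x| < ε := by
  -- `δ < ε` localises the root; `δ < 1` keeps `t ± δ` off the integers and isolates the sign change
  -- at `m = t`.
  obtain ⟨δ, h0, h1⟩ := exists_between (lt_min hε one_pos)
  obtain ⟨hδε, hδ1⟩ := lt_min_iff.1 h1
  have hm : ∀ m : ℕ, (m : ℝ) ≠ t - δ := fun m => by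
    rw [sub_eq_add_neg]
    exact natCast_ne_add_of_abs_lt_one (by rwa [abs_neg, abs_of_pos h0])
      (by rwa [abs_neg, abs_of_pos h0]) m
  have hp : ∀ m : ℕ, (m : ℝ) ≠ t + δ :=
    natCast_ne_add_of_abs_lt_one (by rwa [abs_of_pos h0]) (by rwa [abs_of_pos h0])
  obtain ⟨N, hN⟩ := Filter.eventually_atTop.1
    ((eventually_eval_aDerangementPoly_div_pos hm ha).and
      (eventually_eval_aDerangementPoly_div_pos hp ha))
  refine ⟨max N t, lt_max_of_lt_right ht, fun n hn => ?_⟩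
  obtain ⟨hNn, htn⟩ := max_lt_iff.1 hn
  obtain ⟨e1, e2⟩ := hN n hNn.le
  have hneg : (aDerangementPoly n a).eval (-(t - δ)) * (aDerangementPoly n a).eval (-(t + δ)) <
      0 := by
    have h := mul_pos e1 e2
    rw [div_mul_div_comm] at h
    by_contra hc
    exact absurd h (not_lt.2
      (div_nonpos_of_nonneg_of_nonpos (not_lt.1 hc) (oneSubPowCoeff_mul_neg h0 hδ1 htn).le))
  have hmem : (0 : ℝ) ∈ Set.uIcc ((aDerangementPoly n a).eval (-(t - δ)))
      ((aDerangementPoly n a).eval (-(t + δ))) := by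
    rw [Set.mem_uIcc]
    rcases mul_neg_iff.1 hneg with h | h
    · exact Or.inr ⟨h.2.le, h.1.le⟩
    · exact Or.inl ⟨h.1.le, h.2.le⟩
  obtain ⟨x, hx, hx0⟩ := intermediate_value_uIcc
    (aDerangementPoly n a).continuous.continuousOn hmem
  refine ⟨x, hx0, lt_of_le_of_lt ?_ hδε⟩
  rw [Set.uIcc_of_ge (by linarith), Set.mem_Icc] at hx
  rw [abs_le]
  constructor <;> linarith [hx.1, hx.2]
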